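/- Let $X$ be a finite set of $m$ alternatives and let $P_+(X)$ be the family of its nonempty subsets. A choice function on $X$ is a map $c:P_+(X)\to X$ with $c(S)\in S$ for all $S$; it is rational if there is a linear ordering (ranking) of $X$ such that $c(S)$ is the maximal element of $S$ for every $S\in P_+(X)$. A social choice function for $n$ individuals is a map $F$ that assigns a choice function $c=F(c_1,\dots,c_n)$ on $X$ to every profile $(c_1,\dots,c_n)$ of rational choice functions on $X$ (so its domain is unrestricted, (U)). Consider the following conditions on $F$. (IRA) For every $S\in P_+(X)$, $c(S)$ is a function of $(c_1(S),\dots,c_n(S))$. (P) $c(S)\in\{c_1(S),\dots,c_n(S)\}$ for every $S\in P_+(X)$ and every profile. (N1') For every permutation $\tau$ of $X$, $F(\tau c_1,\dots,\tau c_n)=\tau F(c_1,\dots,c_n)$, where $(\tau c)(S)=\tau(c(\tau^{-1}S))$. (A2') There is a transitive group $\Gamma$ of permutations of $\{1,\dots,n\}$ such that $F(c_{g(1)},\dots,c_{g(n)})=F(c_1,\dots,c_n)$ for all $g\in\Gamma$ and all profiles. (M') If $c(S)=s$ and $c_i(S)=t\ne s$, then replacing the rational choice function $c_i$ of individual $i$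 by one whose choice from $S$ is $s$ (the other individuals being unchanged) does not change $c(S)$. Then for every $m$ there is a number $N=N(m)$ such that for every $n>N$, every set $X$ of $m$ alternatives, every choice function $c$ on $X$ and every social choice function $F$ for $n$ individuals on $X$ satisfying (IRA), (P), (N1'), (A2') and (M'), there is a profile of rational choice functions $c_1,\dots,c_n$ with $c=F(c_1,\dots,c_n)$. -/

import Mathlib

namespace SocialChoice

/-- `P₊(X)`: the family of nonempty subsets of the (finite) set `X` of alternatives. -/
abbrev NonemptySubset (X : Type*) : Type _ := {S : Finset X // S.Nonempty}

/-- The image of a nonempty subset under a permutation of the alternatives. -/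
def NonemptySubset.permute {X : Type*} (τ : Equiv.Perm X) (S : NonemptySubset X) :
    NonemptySubset X :=
  ⟨S.1.map τ.toEmbedding, S.2.map⟩

/-- A choice function on `X`: it picks an element `c(S) ∈ S` from every nonempty subset `S`. -/
@[ext]
structure ChoiceFunction (X : Type*) where
  /-- The chosen alternative. -/
  pick : NonemptySubset X → X
  pick_mem : ∀ S : NonemptySubset X, pick S ∈ S.1

/-- A choice function is rational if there is a linear ordering (ranking) of the alternatives
such that `c(S)` is the maximal element of `S` for every nonempty `S`. -/
def ChoiceFunction.IsRational {X : Type*} (c : ChoiceFunction X) : Prop :=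
  ∃ r : LinearOrder X, ∀ S : NonemptySubset X, ∀ a ∈ S.1, r.le a (c.pick S)

/-- The type of rational choice functions on `X`. -/
abbrev RationalChoice (X : Type*) : Type _ := {c : ChoiceFunction X // c.IsRational}

/-- Relabelling the alternatives by `τ` turns `c` into `S ↦ τ (c (τ⁻¹ S))`. -/
def ChoiceFunction.permute {X : Type*} (τ : Equiv.Perm X) (c : ChoiceFunction X) :
    ChoiceFunction X where
  pick S := τ (c.pick (S.permute τ⁻¹))
  pick_mem S := by
    have h := c.pick_mem (S.permute τ⁻¹)
    obtain ⟨a, ha, hac⟩ := Finset.mem_map.mp h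
    rw [← hac]
    simpa using ha

/-- Relabelling the alternatives preserves rationality. -/
theorem ChoiceFunction.IsRational.permute {X : Type*} (τ : Equiv.Perm X) {c : ChoiceFunction X}
    (hc : c.IsRational) : (c.permute τ).IsRational := by
  obtain ⟨r, hr⟩ := hc
  refine ⟨LinearOrder.lift' (fun x : X => τ⁻¹ x) (τ⁻¹).injective, fun S a ha => ?_⟩
  have h := hr (S.permute τ⁻¹) (τ⁻¹ a) (Finset.mem_map_of_mem _ ha)
  change r.le (τ⁻¹ a) (τ⁻¹ (τ (c.pick (S.permute τ⁻¹))))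
  simpa using h

/-- Relabelling the alternatives in a rational choice function. -/
def RationalChoice.permute {X : Type*} (τ : Equiv.Perm X) (c : RationalChoice X) :
    RationalChoice X :=
  ⟨c.1.permute τ, c.2.permute τ⟩

/-- A profile: one rational choice function for each of the `n` individuals. -/
abbrev Profile (n : ℕ) (X : Type*) : Type _ := Fin n → RationalChoice X

/-- A social choice function `c = F(c₁, …, cₙ)`. It is defined on all rational profiles, that is,
its domain is unrestricted (U). -/
abbrev SocialChoiceFunction (n : ℕ) (X : Type*) : Type _ := Profile n X → ChoiceFunction X

namespace SocialChoiceFunction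

variable {n : ℕ} {X : Type*}

/-- (IRA) Independence of rejected alternatives: `c(S)` is a function of
`(c₁(S), …, cₙ(S))`. -/
def IRA (F : SocialChoiceFunction n X) : Prop :=
  ∀ S : NonemptySubset X, ∀ p p' : Profile n X,
    (∀ i, (p i).1.pick S = (p' i).1.pick S) → (F p).pick S = (F p').pick S

/-- (P) Pareto: `c(S) ∈ {c₁(S), …, cₙ(S)}`. -/
def Pareto (F : SocialChoiceFunction n X) : Prop :=
  ∀ (p : Profile n X) (S : NonemptySubset X), ∃ i, (F p).pick S = (p i).1.pick S

/-- (N1') Neutrality: relabelling the alternatives in all individual choice functions relabels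
the social choice accordingly. -/
def Neutral (F : SocialChoiceFunction n X) : Prop :=
  ∀ (τ : Equiv.Perm X) (p : Profile n X),
    F (fun i => (p i).permute τ) = (F p).permute τ

/-- (A2') Weak anonymity: the social choice is invariant under a transitive group of permutations
of the individuals. -/
def WeaklyAnonymous (F : SocialChoiceFunction n X) : Prop :=
  ∃ Γ : Subgroup (Equiv.Perm (Fin n)),
    (∀ i j : Fin n, ∃ g ∈ Γ, g i = j) ∧
      ∀ g ∈ Γ, ∀ p : Profile n X, F (fun i => p (g i)) = F p

/-- (M') Monotonicity: if `c(S) = s` and `cᵢ(S) = t ≠ s`, then changing the choice of individual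
`i` from `t` to `s` does not change `c(S)`. -/
def Monotone (F : SocialChoiceFunction n X) : Prop :=
  ∀ (S : NonemptySubset X) (p : Profile n X) (i : Fin n) (d : RationalChoice X),
    (p i).1.pick S ≠ (F p).pick S → d.1.pick S = (F p).pick S →
      (F (Function.update p i d)).pick S = (F p).pick S

end SocialChoiceFunction

end SocialChoice

/-!
A random profile of independent voters, drawn with suitable weights on the rational choice
functions, realizes `c` with positive probability once the number of voters is large.

*The weights.* There are weights on the rational choice functions under which, for every `S` at
once, `c S` is the strict plurality choice (`exists_plurality_weights`). Start from equal
weights, where by symmetry every set has an exact tie. For each `S` exchange some weight from a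
ranking with `c S` last in `S`, below everything outside `S`, to the ranking in which `c S` is
moved up to the first place in `S`. This makes `c S` win on `S`, and it affects only sets
contained in `S`, so exchanges for smaller sets can be made to dominate those for larger sets.

*One set.* By independence of rejected alternatives, on a fixed `S` the function `F` acts through
a rule `φ : Sⁿ → S`, and the votes on `S` are independent with common weights `ν` for which some
`s` is strictly more popular than `t`. Suppose that `t` is chosen with probability at least `δ`.
Replace every vote by a vote for `t` with probability `x`, and increase `x` from `0` to the value
`x₁` at which `s` and `t` tie. By monotonicity the probability of choosing `t` increases with
`x`; by neutrality it is at most `1/2` at `x₁`. So the variance of the event "`t` is chosen" is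
bounded below along the path, while by the Margulis–Russo formula (`hasDerivAt_expect_tilt`) its
total influence is bounded at some point of the path. By weak anonymity all `n` voters have the
same influence, which is therefore `O(1/n)`. A theorem in the style of Kahn, Kalai and Linial
(`IsMonotoneEvent.card_le_of_influence_le`) then bounds `n`. Hence `t` is chosen with probability
less than `δ` when `n` is large (`expect_chosen_lt`), and a union bound over `S` and `t` finishes
the proof.

*Influences.* The bound on `n` follows Falik and Samorodnitsky. Write `f - E f` as a sum of
martingale differences `d k` by averaging out the coordinates one by one. The logarithmic Sobolev
inequality (`ent_sq_le`), summed over `k`, bounds the sum of the entropies of `(d k) ^ 2` by a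
constant times the total influence. On the other hand the `L¹` norm of `d k` is at most twice the
influence of `k`, far below its typical `L²` norm, so these entropies are large (`le_ent_sq`).
-/

namespace SharpThreshold

/-! ### Expectations and averages on product spaces -/

variable {B : Type*} [Fintype B] {n : ℕ}

/-- Expectation over `Bⁿ` when the coordinates are independent with common weights `ν`. -/
noncomputable def expect (ν : B → ℝ) : ((Fin n → B) → ℝ) →ₗ[ℝ] ℝ where
  toFun g := ∑ y, (∏ i, ν (y i)) * g y
  map_add' g h := by simp [mul_add, Finset.sum_add_distrib]
  map_smul' r g := by
    simp only [Pi.smul_apply, smul_eq_mul, RingHom.id_apply, Finset.mul_sum]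
    exact Finset.sum_congr rfl fun y _ => by ring

/-- Averaging over coordinate `i` with weights `ν`: the conditional expectation given all the
other coordinates. -/
noncomputable def avg (ν : B → ℝ) (i : Fin n) :
    ((Fin n → B) → ℝ) →ₗ[ℝ] ((Fin n → B) → ℝ) where
  toFun g y := ∑ a, ν a * g (Function.update y i a)
  map_add' g h := by
    ext y
    simp [mul_add, Finset.sum_add_distrib]
  map_smul' r g := by
    ext y
    simp only [Pi.smul_apply, smul_eq_mul, RingHom.id_apply, Finset.mul_sum]
    exact Finset.sum_congr rfl fun y _ => by ring

theorem expect_apply (ν : B → ℝ) (g : (Fin n → B) → ℝ) :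
    expect ν g = ∑ y, (∏ i, ν (y i)) * g y := rfl

theorem avg_apply (ν : B → ℝ) (i : Fin n) (g : (Fin n → B) → ℝ) (y : Fin n → B) :
    avg ν i g y = ∑ a, ν a * g (Function.update y i a) := rfl

/-- `g` does not depend on coordinate `i`. -/
def IndepOf (i : Fin n) (g : (Fin n → B) → ℝ) : Prop :=
  ∀ y a, g (Function.update y i a) = g y

theorem indepOf_avg (ν : B → ℝ) (i : Fin n) (g : (Fin n → B) → ℝ) : IndepOf i (avg ν i g) := by
  intro y a
  simp [avg_apply]

theorem IndepOf.avg {ν : B → ℝ} {i : Fin n} (j : Fin n) {g : (Fin n → B) → ℝ}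
    (hg : IndepOf i g) : IndepOf i (avg ν j g) := by
  rcases eq_or_ne i j with rfl | hij
  · exact indepOf_avg ν i g
  · intro y a
    simp only [avg_apply]
    refine Finset.sum_congr rfl fun b _ => ?_
    rw [Function.update_comm hij, hg]

/-- A function that depends on no single coordinate is constant. -/
theorem IndepOf.eq_of_forall {A : Type*} {g : (Fin n → A) → ℝ} (hg : ∀ i, IndepOf i g)
    (y z : Fin n → A) : g y = g z := by
  classical
  have h : ∀ s : Finset (Fin n), g (s.piecewise y z) = g z := by
    intro s
    induction s using Finset.induction_on with
    | empty => simp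
    | insert i s _ ih => rw [Finset.piecewise_insert, hg i, ih]
  simpa using h Finset.univ

theorem avg_mul_of_indepOf (ν : B → ℝ) {i : Fin n} {k : (Fin n → B) → ℝ} (hk : IndepOf i k)
    (h : (Fin n → B) → ℝ) : avg ν i (k * h) = k * avg ν i h := by
  ext y
  simp only [avg_apply, Pi.mul_apply, Finset.mul_sum, hk y]
  exact Finset.sum_congr rfl fun a _ => by ring

theorem avg_of_indepOf {ν : B → ℝ} (hν : ∑ a, ν a = 1) {i : Fin n} {k : (Fin n → B) → ℝ}
    (hk : IndepOf i k) : avg ν i k = k := by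
  ext y
  simp only [avg_apply, hk y, ← Finset.sum_mul, hν, one_mul]

theorem avg_comm (ν : B → ℝ) (i j : Fin n) (g : (Fin n → B) → ℝ) :
    avg ν i (avg ν j g) = avg ν j (avg ν i g) := by
  rcases eq_or_ne i j with rfl | hij
  · rfl
  · ext y
    simp only [avg_apply, Finset.mul_sum]
    rw [Finset.sum_comm]
    refine Finset.sum_congr rfl fun a _ => Finset.sum_congr rfl fun b _ => ?_
    rw [Function.update_comm hij]
    ring

theorem avg_nonneg {ν : B → ℝ} (hν : ∀ a, 0 ≤ ν a) (i : Fin n) {g : (Fin n → B) → ℝ}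
    (hg : ∀ y, 0 ≤ g y) (y : Fin n → B) : 0 ≤ avg ν i g y :=
  Finset.sum_nonneg fun a _ => mul_nonneg (hν a) (hg _)

theorem expect_nonneg {ν : B → ℝ} (hν : ∀ a, 0 ≤ ν a) {g : (Fin n → B) → ℝ}
    (hg : ∀ y, 0 ≤ g y) : 0 ≤ expect ν g :=
  Finset.sum_nonneg fun y _ => mul_nonneg (Finset.prod_nonneg fun _ _ => hν _) (hg y)

theorem expect_mono {ν : B → ℝ} (hν : ∀ a, 0 ≤ ν a) {g h : (Fin n → B) → ℝ}
    (hgh : ∀ y, g y ≤ h y) : expect ν g ≤ expect ν h := by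
  have := expect_nonneg hν (g := h - g) fun y => sub_nonneg.2 (hgh y)
  rw [map_sub] at this
  linarith

theorem expect_const {ν : B → ℝ} (hν : ∑ a, ν a = 1) (r : ℝ) :
    expect ν (fun _ : Fin n → B => r) = r := by
  classical
  have h := Finset.prod_univ_sum (fun _ : Fin n => (Finset.univ : Finset B)) (fun _ a => ν a)
  simp only [hν, Finset.prod_const_one, Fintype.piFinset_univ] at h
  rw [expect_apply, ← Finset.sum_mul, ← h, one_mul]

/-- Resampling coordinate `i` from `μ` amounts to giving that coordinate the weights `μ`. -/
theorem expect_avg_eq {ν : B → ℝ} (hν : ∑ a, ν a = 1) (μ : B → ℝ) (i : Fin n)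
    (g : (Fin n → B) → ℝ) :
    expect ν (avg μ i g) = ∑ y, (∏ j ∈ Finset.univ.erase i, ν (y j)) * μ (y i) * g y := by
  have key : ∀ (y : Fin n → B) (a : B), ∏ j ∈ Finset.univ.erase i, ν (Function.update y i a j) =
      ∏ j ∈ Finset.univ.erase i, ν (y j) := fun y a =>
    Finset.prod_congr rfl fun j hj => by rw [Function.update_of_ne (Finset.ne_of_mem_erase hj)]
  -- Exchange the old value of coordinate `i` with the resampled one.
  let e : (Fin n → B) × B ≃ (Fin n → B) × B :=
    { toFun := fun q => (Function.update q.1 i q.2, q.1 i)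
      invFun := fun q => (Function.update q.1 i q.2, q.1 i)
      left_inv := fun q => by simp
      right_inv := fun q => by simp }
  calc expect ν (avg μ i g)
      = ∑ q : (Fin n → B) × B, (∏ j, ν (q.1 j)) * (μ q.2 * g (Function.update q.1 i q.2)) := by
        simp only [expect_apply, avg_apply, Finset.mul_sum, Fintype.sum_prod_type]
    _ = ∑ q : (Fin n → B) × B,
          (∏ j ∈ Finset.univ.erase i, ν (q.1 j)) * ν q.2 * (μ (q.1 i) * g q.1) := by
        refine Fintype.sum_equiv e _ _ fun q => ?_
        simp only [e, Equiv.coe_fn_mk, key, Function.update_self]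
        rw [Finset.prod_erase_mul _ _ (Finset.mem_univ i)]
    _ = _ := by
        rw [Fintype.sum_prod_type]
        refine Finset.sum_congr rfl fun y _ => ?_
        dsimp only
        rw [← Finset.sum_mul, ← Finset.mul_sum, hν]
        ring

theorem expect_avg {ν : B → ℝ} (hν : ∑ a, ν a = 1) (i : Fin n) (g : (Fin n → B) → ℝ) :
    expect ν (avg ν i g) = expect ν g := by
  rw [expect_avg_eq hν, expect_apply]
  exact Finset.sum_congr rfl fun y _ => by rw [Finset.prod_erase_mul _ _ (Finset.mem_univ i)]

/-- Relabelling the coordinates does not change expectations. -/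
theorem expect_comp_perm (ν : B → ℝ) (σ : Equiv.Perm (Fin n)) (g : (Fin n → B) → ℝ) :
    expect ν (fun y => g (y ∘ σ)) = expect ν g := by
  simp only [expect_apply]
  refine Fintype.sum_equiv (σ.symm.arrowCongr (Equiv.refl B)) _ _ fun y => ?_
  have : (σ.symm.arrowCongr (Equiv.refl B)) y = y ∘ σ := by ext; simp
  rw [this]
  congr 1
  exact (Equiv.prod_comp σ fun i => ν (y i)).symm

/-- Relabelling the letters by a weight-preserving permutation does not change expectations. -/
theorem expect_comp_letters {ν : B → ℝ} (σ : Equiv.Perm B) (hσ : ∀ a, ν (σ a) = ν a)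
    (g : (Fin n → B) → ℝ) : expect ν (fun y => g (σ ∘ y)) = expect ν g := by
  simp only [expect_apply]
  refine Fintype.sum_equiv ((Equiv.refl _).arrowCongr σ) _ _ fun y => ?_
  have : ((Equiv.refl (Fin n)).arrowCongr σ) y = σ ∘ y := by ext; simp
  rw [this]
  simp [hσ]

/-- Averaging over a coordinate is an orthogonal projection. -/
theorem expect_sub_avg_sq {ν : B → ℝ} (hν : ∑ a, ν a = 1) (i : Fin n) (g : (Fin n → B) → ℝ) :
    expect ν ((g - avg ν i g) ^ 2) = expect ν (g ^ 2) - expect ν ((avg ν i g) ^ 2) := by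
  have h : expect ν (avg ν i g * g) = expect ν ((avg ν i g) ^ 2) := by
    rw [← expect_avg hν i, avg_mul_of_indepOf ν (indepOf_avg ν i g), sq]
  have e : (g - avg ν i g) ^ 2 = g ^ 2 - (2 : ℝ) • (avg ν i g * g) + (avg ν i g) ^ 2 := by
    ext y
    simp only [Pi.pow_apply, Pi.sub_apply, Pi.add_apply, Pi.smul_apply, Pi.mul_apply, smul_eq_mul]
    ring
  rw [e, map_add, map_sub, map_smul, h, smul_eq_mul]
  ring

/-! ### Averaging out the coordinates one after the other -/

/-- Averaging over the first `k` coordinates. -/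
noncomputable def avgBelow (ν : B → ℝ) : ℕ → ((Fin n → B) → ℝ) →ₗ[ℝ] ((Fin n → B) → ℝ)
  | 0 => LinearMap.id
  | k + 1 => if h : k < n then avg ν ⟨k, h⟩ ∘ₗ avgBelow ν k else avgBelow ν k

theorem avgBelow_zero (ν : B → ℝ) (g : (Fin n → B) → ℝ) : avgBelow ν 0 g = g := rfl

theorem avgBelow_succ (ν : B → ℝ) (k : Fin n) (g : (Fin n → B) → ℝ) :
    avgBelow ν (k + 1) g = avg ν k (avgBelow ν k g) := by
  simp [avgBelow]

/-- Induction principle for `avgBelow`: a property of operators that holds for the identity and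
survives averaging over one more coordinate holds for all `avgBelow ν k`. -/
theorem avgBelow_induction {ν : B → ℝ} {g : (Fin n → B) → ℝ} (p : ((Fin n → B) → ℝ) → Prop)
    (h0 : p g) (h1 : ∀ i g, p g → p (avg ν i g)) (k : ℕ) : p (avgBelow ν k g) := by
  induction k with
  | zero => exact h0
  | succ k ih =>
    by_cases h : k < n
    · simpa [avgBelow, h] using h1 ⟨k, h⟩ _ ih
    · simpa [avgBelow, h] using ih

theorem avgBelow_avg (ν : B → ℝ) (k : ℕ) (i : Fin n) (g : (Fin n → B) → ℝ) :
    avgBelow ν k (avg ν i g) = avg ν i (avgBelow ν k g) := by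
  induction k with
  | zero => rfl
  | succ k ih =>
    by_cases h : k < n
    · simp [avgBelow, h, ih, avg_comm ν i]
    · simp [avgBelow, h, ih]

theorem expect_avgBelow {ν : B → ℝ} (hν : ∑ a, ν a = 1) (k : ℕ) (g : (Fin n → B) → ℝ) :
    expect ν (avgBelow ν k g) = expect ν g :=
  avgBelow_induction (fun h => expect ν h = expect ν g) rfl
    (fun i h hh => by rw [expect_avg hν, hh]) k

theorem avgBelow_nonneg {ν : B → ℝ} (hν : ∀ a, 0 ≤ ν a) (k : ℕ) {g : (Fin n → B) → ℝ}
    (hg : ∀ y, 0 ≤ g y) : ∀ y, 0 ≤ avgBelow ν k g y :=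
  avgBelow_induction (fun h => ∀ y, 0 ≤ h y) hg (fun i _ hh => avg_nonneg hν i hh) k

theorem avgBelow_mono {ν : B → ℝ} (hν : ∀ a, 0 ≤ ν a) (k : ℕ) {g h : (Fin n → B) → ℝ}
    (hgh : ∀ y, g y ≤ h y) (y : Fin n → B) : avgBelow ν k g y ≤ avgBelow ν k h y := by
  have := avgBelow_nonneg hν k (g := h - g) (fun y => sub_nonneg.2 (hgh y)) y
  rw [map_sub, Pi.sub_apply] at this
  linarith

theorem IndepOf.avgBelow {ν : B → ℝ} {i : Fin n} {g : (Fin n → B) → ℝ} (hg : IndepOf i g)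
    (k : ℕ) : IndepOf i (avgBelow ν k g) :=
  avgBelow_induction (IndepOf i) hg (fun j _ hh => hh.avg j) k

/-- Averaging over all coordinates gives the expectation. -/
theorem avgBelow_all {ν : B → ℝ} (hν : ∑ a, ν a = 1) (g : (Fin n → B) → ℝ) :
    avgBelow ν n g = fun _ => expect ν g := by
  have ind : ∀ k : ℕ, ∀ i : Fin n, (i : ℕ) < k → IndepOf i (avgBelow ν k g) := by
    intro k
    induction k with
    | zero => intro i hi; omega
    | succ k ih =>
      intro i hi
      by_cases h : k < n
      · rw [show k + 1 = ((⟨k, h⟩ : Fin n) : ℕ) + 1 from rfl, avgBelow_succ]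
        rcases Nat.lt_succ_iff_lt_or_eq.1 hi with h' | h'
        · exact (ih i h').avg _
        · have : i = ⟨k, h⟩ := Fin.ext h'
          rw [this]
          exact indepOf_avg ν _ _
      · simpa [avgBelow, h] using ih i (by omega)
  ext y
  have h := expect_avgBelow hν n g
  have : avgBelow ν n g = fun _ => avgBelow ν n g y := by
    ext z
    exact IndepOf.eq_of_forall (fun i => ind n i i.2) z y
  rw [this, expect_const hν] at h
  exact h

/-- Cauchy–Schwarz inequality for the positive operator `avgBelow ν k`. -/
theorem avgBelow_mul_sq_le {ν : B → ℝ} (hν : ∀ a, 0 ≤ ν a) (k : ℕ) (g h : (Fin n → B) → ℝ)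
    (y : Fin n → B) :
    (avgBelow ν k (g * h) y) ^ 2 ≤ avgBelow ν k (g ^ 2) y * avgBelow ν k (h ^ 2) y := by
  have key : ∀ r : ℝ, 0 ≤ avgBelow ν k (h ^ 2) y * (r * r) +
      (2 * avgBelow ν k (g * h) y) * r + avgBelow ν k (g ^ 2) y := by
    intro r
    have h0 := avgBelow_nonneg hν k (g := (g + r • h) ^ 2) (fun z => sq_nonneg _) y
    have e : (g + r • h) ^ 2 = (r * r) • h ^ 2 + (2 * r) • (g * h) + g ^ 2 := by
      ext z
      simp only [Pi.pow_apply, Pi.add_apply, Pi.smul_apply, Pi.mul_apply, smul_eq_mul]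
      ring
    rw [e, map_add, map_add, map_smul, map_smul] at h0
    simp only [Pi.add_apply, Pi.smul_apply, smul_eq_mul] at h0
    linarith
  have := discrim_le_zero key
  rw [discrim] at this
  linarith

/-- The martingale differences obtained by averaging out the coordinates one after the other
are orthogonal, so their squared norms add up to the variance. -/
theorem sum_expect_sub_sq {ν : B → ℝ} (hν : ∑ a, ν a = 1) (g : (Fin n → B) → ℝ) :
    ∑ k : Fin n, expect ν ((avgBelow ν k g - avg ν k (avgBelow ν k g)) ^ 2) =
      expect ν (g ^ 2) - (expect ν g) ^ 2 := by
  have h : ∀ k : Fin n, expect ν ((avgBelow ν k g - avg ν k (avgBelow ν k g)) ^ 2) =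
      expect ν ((avgBelow ν k g) ^ 2) - expect ν ((avgBelow ν (k + 1) g) ^ 2) := fun k => by
    rw [expect_sub_avg_sq hν, avgBelow_succ]
  rw [Finset.sum_congr rfl fun k _ => h k,
    ← Finset.sum_range fun k : ℕ => expect ν ((avgBelow ν k g) ^ 2) -
      expect ν ((avgBelow ν (k + 1) g) ^ 2),
    Finset.sum_range_sub', avgBelow_zero, avgBelow_all hν]
  congr 1
  exact expect_const hν _

/-! ### Entropy and the logarithmic Sobolev inequality -/

/-- Entropy of a nonnegative function under the product weights, with `0 log 0 = 0`. -/
noncomputable def ent (ν : B → ℝ) (h : (Fin n → B) → ℝ) : ℝ :=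
  expect ν (fun y => h y * Real.log (h y)) - expect ν h * Real.log (expect ν h)

/-- On one coordinate, entropy is at most variance over mean; the variance is bounded by the
second moment about an arbitrary `c`. -/
theorem sum_mul_log_sub_le {ν : B → ℝ} (hν : ∀ a, 0 ≤ ν a) (h1 : ∑ a, ν a = 1) {H : B → ℝ}
    (hH : ∀ a, 0 ≤ H a) {M : ℝ} (hM : M = ∑ a, ν a * H a) (hM0 : 0 < M) (c : ℝ) :
    ∑ a, ν a * (H a * Real.log (H a)) - M * Real.log M ≤ (∑ a, ν a * (H a - c) ^ 2) / M := by
  have h : ∀ a, H a * Real.log (H a) ≤ H a * Real.log M + H a * (H a / M - 1) := by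
    intro a
    rcases (hH a).eq_or_lt with h0 | h0
    · simp [← h0]
    · have := Real.log_le_sub_one_of_pos (div_pos h0 hM0)
      rw [Real.log_div h0.ne' hM0.ne'] at this
      nlinarith
  have h2 : ∑ a, ν a * (H a * Real.log (H a)) ≤
      ∑ a, ν a * (H a * Real.log M + H a * (H a / M - 1)) :=
    Finset.sum_le_sum fun a _ => mul_le_mul_of_nonneg_left (h a) (hν a)
  have h3 : ∑ a, ν a * (H a * Real.log M + H a * (H a / M - 1)) =
      M * Real.log M + (∑ a, ν a * (H a) ^ 2) / M - M := by
    rw [hM, Finset.sum_mul, Finset.sum_div, ← Finset.sum_add_distrib, ← Finset.sum_sub_distrib,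
      ← hM]
    refine Finset.sum_congr rfl fun a _ => ?_
    field_simp
    ring
  have h4 : ∑ a, ν a * (H a - c) ^ 2 = ∑ a, ν a * (H a) ^ 2 - 2 * c * M + c ^ 2 := by
    have : c ^ 2 = ∑ a, ν a * c ^ 2 := by rw [← Finset.sum_mul, h1, one_mul]
    rw [this, hM, Finset.mul_sum, ← Finset.sum_sub_distrib, ← Finset.sum_add_distrib]
    exact Finset.sum_congr rfl fun a _ => by ring
  have h5 : (∑ a, ν a * (H a) ^ 2) / M - M ≤ (∑ a, ν a * (H a - c) ^ 2) / M := by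
    rw [h4, div_sub' hM0.ne']
    gcongr
    nlinarith [sq_nonneg (M - c)]
  linarith

/-- Averaging `h` over one more coordinate, where `h` is `g ^ 2` averaged over the first `k`
coordinates, lowers the expectation of `h log h` by at most a constant times the expected variance
of `g` in that coordinate. -/
theorem expect_ent_step {ν : B → ℝ} {α : ℝ} (hα : 0 < α) (hν : ∀ a, α ≤ ν a)
    (h1 : ∑ a, ν a = 1) (g : (Fin n → B) → ℝ) (k : Fin n) :
    expect ν (fun y => avgBelow ν k (g ^ 2) y * Real.log (avgBelow ν k (g ^ 2) y)) -
      expect ν (fun y => avgBelow ν (k + 1) (g ^ 2) y * Real.log (avgBelow ν (k + 1) (g ^ 2) y)) ≤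
    4 / α * expect ν ((g - avg ν k g) ^ 2) := by
  have hν0 : ∀ a, 0 ≤ ν a := fun a => hα.le.trans (hν a)
  set H := avgBelow ν k (g ^ 2) with hHdef
  have hH : ∀ y, 0 ≤ H y := avgBelow_nonneg hν0 k fun y => sq_nonneg _
  set Δ := avgBelow ν k ((g - avg ν k g) ^ 2) with hΔdef
  have hΔ : ∀ y, 0 ≤ Δ y := avgBelow_nonneg hν0 k fun y => sq_nonneg _
  -- Cauchy–Schwarz for `g² - m² = (g - m)(g + m)`, where `m` is the average of `g` over `k`.
  have hpt : ∀ y, avg ν k (fun y => H y * Real.log (H y)) y -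
      avg ν k H y * Real.log (avg ν k H y) ≤ 4 / α * avg ν k Δ y := by
    intro y
    set M := avg ν k H y with hMdef
    have hM0 : 0 ≤ M := avg_nonneg hν0 k hH y
    rcases hM0.eq_or_lt with h0 | h0
    · have hz : ∀ a, H (Function.update y k a) = 0 := by
        intro a
        have := (Finset.sum_eq_zero_iff_of_nonneg
          (fun a _ => mul_nonneg (hν0 a) (hH (Function.update y k a)))).1 h0.symm a
          (Finset.mem_univ a)
        exact (mul_eq_zero.1 this).resolve_left (hα.trans_le (hν a)).ne'
      have : avg ν k (fun y => H y * Real.log (H y)) y = 0 := by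
        rw [avg_apply]
        simp [hz]
      rw [this, ← h0]
      have := avg_nonneg hν0 k hΔ y
      have : 0 ≤ 4 / α * avg ν k Δ y := by positivity
      simpa using this
    · set c := avgBelow ν k ((avg ν k g) ^ 2) y with hc
      have hci : IndepOf k (avgBelow ν k ((avg ν k g) ^ 2)) := by
        refine IndepOf.avgBelow (fun z a => ?_) k
        simp only [Pi.pow_apply, indepOf_avg ν k g z a]
      have hα1 : α ≤ 1 := by
        obtain ⟨a⟩ : Nonempty B := ⟨y k⟩
        rw [← h1]
        exact (hν a).trans (Finset.single_le_sum (fun b _ => hν0 b) (Finset.mem_univ a))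
      have hcM : c ≤ M := by
        have e : M = avgBelow ν k (avg ν k (g ^ 2)) y := by rw [avgBelow_avg]
        rw [e]
        refine avgBelow_mono hν0 k (fun z => ?_) y
        have h := Finset.sum_nonneg fun a (_ : a ∈ Finset.univ) =>
          mul_nonneg (hν0 a) (sq_nonneg (g (Function.update z k a) - avg ν k g z))
        have e2 : ∑ a, ν a * (g (Function.update z k a) - avg ν k g z) ^ 2 =
            avg ν k (g ^ 2) z - (avg ν k g z) ^ 2 := by
          have h3 : (avg ν k g z) ^ 2 = 2 * avg ν k g z * (∑ a, ν a * g (Function.update z k a)) -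
              ∑ a, ν a * (avg ν k g z) ^ 2 := by
            rw [← Finset.sum_mul, h1, ← avg_apply]
            ring
          rw [h3, avg_apply ν k (g ^ 2), Finset.mul_sum, ← Finset.sum_sub_distrib,
            ← Finset.sum_sub_distrib]
          exact Finset.sum_congr rfl fun a _ => by simp only [Pi.pow_apply]; ring
        rw [e2] at h
        simp only [Pi.pow_apply]
        linarith
      have hbound : ∀ a, (H (Function.update y k a) - c) ^ 2 ≤
          Δ (Function.update y k a) * (4 / α * M) := by
        intro a
        set z := Function.update y k a with hz
        have hcz : c = avgBelow ν k ((avg ν k g) ^ 2) z := (hci y a).symm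
        have e1 : H z - c = avgBelow ν k ((g - avg ν k g) * (g + avg ν k g)) z := by
          rw [hcz, hHdef, ← Pi.sub_apply, ← map_sub,
            show (g - avg ν k g) * (g + avg ν k g) = g ^ 2 - avg ν k g ^ 2 by ring]
        have e2 : avgBelow ν k ((g + avg ν k g) ^ 2) z ≤ 2 * H z + 2 * c := by
          have : avgBelow ν k ((2 : ℝ) • g ^ 2 + (2 : ℝ) • (avg ν k g) ^ 2) z =
              2 * H z + 2 * c := by
            rw [map_add, map_smul, map_smul, hcz]
            rfl
          rw [← this]
          refine avgBelow_mono hν0 k (fun w => ?_) z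
          simp only [Pi.pow_apply, Pi.add_apply, Pi.smul_apply, smul_eq_mul]
          nlinarith [sq_nonneg (g w - avg ν k g w)]
        have e3 : α * H z ≤ M := by
          have := Finset.single_le_sum (f := fun a => ν a * H (Function.update y k a))
            (fun a _ => mul_nonneg (hν0 a) (hH _)) (Finset.mem_univ a)
          exact (mul_le_mul_of_nonneg_right (hν a) (hH z)).trans this
        have e4 : 2 * H z + 2 * c ≤ 4 / α * M := by
          rw [div_mul_eq_mul_div, le_div_iff₀ hα]
          nlinarith
        rw [e1]
        refine (avgBelow_mul_sq_le hν0 k _ _ z).trans ?_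
        exact mul_le_mul_of_nonneg_left (e2.trans e4) (hΔ z)
      refine (sum_mul_log_sub_le hν0 h1 (fun a => hH (Function.update y k a)) hMdef h0 c).trans ?_
      rw [div_le_iff₀ h0, avg_apply, Finset.mul_sum, Finset.sum_mul]
      refine Finset.sum_le_sum fun a _ => ?_
      calc _ ≤ ν a * (Δ (Function.update y k a) * (4 / α * M)) :=
            mul_le_mul_of_nonneg_left (hbound a) (hν0 a)
        _ = _ := by ring
  have h2 := expect_mono hν0 (g := avg ν k (fun y => H y * Real.log (H y)) -
      fun y => avg ν k H y * Real.log (avg ν k H y)) (h := (4 / α) • avg ν k Δ) hpt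
  rw [map_sub, map_smul, expect_avg h1, expect_avg h1, hΔdef, expect_avgBelow h1, smul_eq_mul] at h2
  rw [avgBelow_succ]
  exact h2

/-- Logarithmic Sobolev inequality on `Bⁿ`, with a constant depending only on the smallest
weight. -/
theorem ent_sq_le {ν : B → ℝ} {α : ℝ} (hα : 0 < α) (hν : ∀ a, α ≤ ν a)
    (h1 : ∑ a, ν a = 1) (g : (Fin n → B) → ℝ) :
    ent ν (g ^ 2) ≤ 4 / α * ∑ k, expect ν ((g - avg ν k g) ^ 2) := by
  rw [Finset.mul_sum]
  refine le_trans (le_of_eq ?_) (Finset.sum_le_sum fun k _ => expect_ent_step hα hν h1 g k)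
  rw [← Finset.sum_range fun k : ℕ => expect ν (fun y => avgBelow ν k (g ^ 2) y *
      Real.log (avgBelow ν k (g ^ 2) y)) - expect ν (fun y => avgBelow ν (k + 1) (g ^ 2) y *
        Real.log (avgBelow ν (k + 1) (g ^ 2) y)),
    Finset.sum_range_sub' (fun k : ℕ => expect ν (fun y => avgBelow ν k (g ^ 2) y *
      Real.log (avgBelow ν k (g ^ 2) y))), avgBelow_zero, avgBelow_all h1, ent]
  rw [expect_const h1]

/-- A function whose `L¹` norm is small compared with its `L²` norm has squares of large
entropy. -/
theorem le_ent_sq {ν : B → ℝ} (hν : ∀ a, 0 ≤ ν a) (d : (Fin n → B) → ℝ) {L : ℝ}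
    (hL0 : 0 < L) (hL : expect ν (fun y => |d y|) ≤ L) :
    expect ν (d ^ 2) * Real.log (expect ν (d ^ 2) / L ^ 2) ≤ ent ν (d ^ 2) := by
  set v := expect ν (d ^ 2) with hv
  have hv0 : 0 ≤ v := expect_nonneg hν fun y => sq_nonneg _
  rcases hv0.eq_or_lt with h0 | h0
  · have : 0 ≤ ent ν (d ^ 2) := by
      have e : ∀ y, (∏ i, ν (y i)) * d y ^ 2 = 0 := fun y =>
        (Finset.sum_eq_zero_iff_of_nonneg fun y _ =>
          mul_nonneg (Finset.prod_nonneg fun i _ => hν _) (sq_nonneg (d y))).1 h0.symm y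
          (Finset.mem_univ y)
      rw [ent, ← hv, ← h0, expect_apply]
      simp only [Pi.pow_apply, ← mul_assoc, e]
      simp
    rw [← h0]
    simpa using this
  · -- `log z ≥ 1 - 1 / z` at `z = L |d| / v`
    have hpt : ∀ y, d y ^ 2 * Real.log (v / L ^ 2) + d y ^ 2 * Real.log v +
        2 * (d y ^ 2 - |d y| * (v / L)) ≤ d y ^ 2 * Real.log (d y ^ 2) := by
      intro y
      rcases (abs_nonneg (d y)).eq_or_lt with h | h
      · have : d y = 0 := abs_eq_zero.1 h.symm
        simp [this]
      · have hz : 0 < L * |d y| / v := by positivity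
        have h2 := Real.one_sub_inv_le_log_of_pos hz
        rw [Real.log_div (by positivity) h0.ne', Real.log_mul hL0.ne' h.ne'] at h2
        rw [Real.log_div h0.ne' (by positivity), Real.log_pow, ← sq_abs, Real.log_pow]
        push_cast
        have e : |d y| ^ 2 * (1 - (L * |d y| / v)⁻¹) = |d y| ^ 2 - |d y| * (v / L) := by
          field_simp
        have h3 := mul_le_mul_of_nonneg_left h2 (sq_nonneg |d y|)
        rw [e] at h3
        nlinarith
    have h2 := expect_mono hν (g := Real.log (v / L ^ 2) • d ^ 2 + Real.log v • d ^ 2 +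
      (2 : ℝ) • (d ^ 2 - (v / L) • fun y => |d y|)) (h := fun y => d y ^ 2 * Real.log (d y ^ 2))
      (fun y => by
        refine le_trans (le_of_eq ?_) (hpt y)
        simp only [Pi.pow_apply, Pi.add_apply, Pi.sub_apply, Pi.smul_apply, smul_eq_mul]
        ring)
    simp only [map_add, map_sub, map_smul, smul_eq_mul, ← hv] at h2
    have h3 : v / L * expect ν (fun y => |d y|) ≤ v := by
      rw [div_mul_eq_mul_div, div_le_iff₀ hL0]
      exact mul_le_mul_of_nonneg_left hL hv0
    rw [ent, ← hv]
    simp only [Pi.pow_apply]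
    linarith

/-! ### Influences of monotone events -/

/-- The influence of coordinate `i` on `f` towards the letter `t`: the expected change of `f` when
coordinate `i` is replaced by `t`. -/
noncomputable def influence (ν : B → ℝ) (t : B) (f : (Fin n → B) → ℝ) (i : Fin n) : ℝ :=
  expect ν (fun y => f (Function.update y i t)) - expect ν f

/-- `f` is the indicator function of an event that is preserved when a coordinate is replaced
by `t`. -/
structure IsMonotoneEvent (t : B) (f : (Fin n → B) → ℝ) : Prop where
  zero_or_one : ∀ y, f y = 0 ∨ f y = 1
  le_update : ∀ y i, f y ≤ f (Function.update y i t)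

theorem IsMonotoneEvent.influence_nonneg {ν : B → ℝ} (hν : ∀ a, 0 ≤ ν a) {t : B}
    {f : (Fin n → B) → ℝ} (hf : IsMonotoneEvent t f) (i : Fin n) : 0 ≤ influence ν t f i :=
  sub_nonneg.2 (expect_mono hν fun y => hf.le_update y i)

/-- For a monotone event the influence towards `t` controls the `L¹` distance of the indicator
function from its average over a coordinate. -/
theorem IsMonotoneEvent.expect_abs_sub_avg_le {ν : B → ℝ} (hν : ∀ a, 0 ≤ ν a)
    (h1 : ∑ a, ν a = 1) {t : B} {f : (Fin n → B) → ℝ} (hf : IsMonotoneEvent t f) (i : Fin n) :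
    expect ν (fun y => |f y - avg ν i f y|) ≤ 2 * influence ν t f i := by
  have hf0 : ∀ y, 0 ≤ f y := fun y => by rcases hf.zero_or_one y with h | h <;> simp [h]
  have hf1 : ∀ y, f y ≤ 1 := fun y => by rcases hf.zero_or_one y with h | h <;> simp [h]
  have hp0 : ∀ y, 0 ≤ avg ν i f y := avg_nonneg hν i hf0
  have hp1 : ∀ y, avg ν i f y ≤ f (Function.update y i t) := by
    intro y
    calc avg ν i f y ≤ ∑ a, ν a * f (Function.update y i t) := by
          refine Finset.sum_le_sum fun a _ => mul_le_mul_of_nonneg_left ?_ (hν a)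
          simpa using hf.le_update (Function.update y i a) i
      _ = _ := by rw [← Finset.sum_mul, h1, one_mul]
  have e1 : (fun y => |f y - avg ν i f y|) = f + avg ν i f - (2 : ℝ) • (avg ν i f * f) := by
    ext y
    simp only [Pi.add_apply, Pi.sub_apply, Pi.smul_apply, Pi.mul_apply, smul_eq_mul]
    have := (hp1 y).trans (hf1 _)
    rcases hf.zero_or_one y with h | h
    · rw [h, zero_sub, abs_neg, abs_of_nonneg (hp0 y)]
      ring
    · rw [h, abs_of_nonneg (by linarith)]
      ring
  have e2 : expect ν (avg ν i f * f) = expect ν (avg ν i f * avg ν i f) := by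
    rw [← expect_avg h1 i, avg_mul_of_indepOf ν (indepOf_avg ν i f)]
  have h := expect_mono hν (g := avg ν i f - avg ν i f * avg ν i f)
    (h := (fun y => f (Function.update y i t)) - avg ν i f) (fun y => by
      simp only [Pi.sub_apply, Pi.mul_apply]
      have h3 := hp1 y
      rcases hf.zero_or_one (Function.update y i t) with h | h
      · have : avg ν i f y = 0 := le_antisymm (h ▸ h3) (hp0 y)
        simp [h, this]
      · rw [h]
        nlinarith [sq_nonneg (1 - avg ν i f y)])
  rw [e1, map_sub, map_add, map_smul, smul_eq_mul, e2]
  rw [map_sub, map_sub] at h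
  rw [influence]
  rw [expect_avg h1] at h ⊢
  linarith

/-- `x ↦ x log x` is convex: a sum of such terms is smallest when all are equal. -/
theorem mul_log_sum_le {v : Fin n → ℝ} (hv : ∀ k, 0 ≤ v k) (hV : 0 < ∑ k, v k) {b : ℝ}
    (hb : 0 < b) :
    (∑ k, v k) * Real.log ((∑ k, v k) / n / b) ≤ ∑ k, v k * Real.log (v k / b) := by
  set V := ∑ k, v k with hVdef
  have hn : (0 : ℝ) < n := by
    rcases Nat.eq_zero_or_pos n with rfl | h
    · simp [hVdef] at hV
    · exact_mod_cast h
  have h : ∀ k, v k * Real.log (V / n / b) + (v k - V / n) ≤ v k * Real.log (v k / b) := by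
    intro k
    rcases (hv k).eq_or_lt with h0 | h0
    · rw [← h0]
      have : 0 < V / n := by positivity
      simp only [zero_mul, zero_sub, zero_add]
      linarith
    · have h2 := Real.one_sub_inv_le_log_of_pos (div_pos h0 (div_pos hV hn))
      rw [Real.log_div h0.ne' (by positivity)] at h2
      rw [Real.log_div (by positivity) hb.ne', Real.log_div h0.ne' hb.ne']
      have h3 := mul_le_mul_of_nonneg_left h2 h0.le
      have e : v k * (1 - (v k / (V / n))⁻¹) = v k - V / n := by field_simp
      rw [e] at h3
      linarith
  have h2 := Finset.sum_le_sum fun k (_ : k ∈ Finset.univ) => h k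
  rw [Finset.sum_add_distrib, ← Finset.sum_mul, Finset.sum_sub_distrib, ← hVdef] at h2
  simp only [Finset.sum_const, Finset.card_univ, Fintype.card_fin, nsmul_eq_mul] at h2
  rw [mul_div_cancel₀ _ hn.ne'] at h2
  linarith

/-- A form of the theorem of Kahn, Kalai and Linial: if the variance of a monotone event is
bounded below while all influences are at most `K / n`, then `n` is bounded. The proof compares
the entropies of the squared martingale differences of `f` with the logarithmic Sobolev
inequality. -/
theorem IsMonotoneEvent.card_le_of_influence_le {ν : B → ℝ} {α : ℝ} (hα : 0 < α)
    (hν : ∀ a, α ≤ ν a) (h1 : ∑ a, ν a = 1) {t : B} {f : (Fin n → B) → ℝ}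
    (hf : IsMonotoneEvent t f) (hn : 0 < n) {K V₀ : ℝ} (hK : 0 < K) (hV₀ : 0 < V₀)
    (hV : V₀ ≤ expect ν (f ^ 2) - (expect ν f) ^ 2)
    (hinf : ∀ i, influence ν t f i ≤ K / n) :
    (n : ℝ) ≤ 4 * K ^ 2 / V₀ * Real.exp (8 * K / (α * V₀)) := by
  have hν0 : ∀ a, 0 ≤ ν a := fun a => hα.le.trans (hν a)
  have hn' : (0 : ℝ) < n := by exact_mod_cast hn
  have hf0 : ∀ y, 0 ≤ f y := fun y => by rcases hf.zero_or_one y with h | h <;> simp [h]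
  have hf1 : ∀ y, f y ≤ 1 := fun y => by rcases hf.zero_or_one y with h | h <;> simp [h]
  set d : Fin n → (Fin n → B) → ℝ := fun k => avgBelow ν k f - avg ν k (avgBelow ν k f) with hd
  have hd' : ∀ k : Fin n, d k = avgBelow ν k (f - avg ν k f) := fun k => by
    rw [map_sub, avgBelow_avg]
  have hL1 : ∀ k : Fin n, expect ν (fun y => |d k y|) ≤ 2 * K / n := by
    intro k
    have h2 : ∀ y, |d k y| ≤ avgBelow ν k (fun y => |f y - avg ν k f y|) y := by
      intro y
      rw [hd' k, abs_le]
      constructor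
      · rw [← Pi.neg_apply, ← map_neg]
        exact avgBelow_mono hν0 k (fun z => neg_abs_le _) y
      · exact avgBelow_mono hν0 k (fun z => le_abs_self _) y
    calc _ ≤ expect ν (fun y => |f y - avg ν k f y|) := by
          rw [← expect_avgBelow h1 k (fun y => |f y - avg ν k f y|)]
          exact expect_mono hν0 h2
      _ ≤ 2 * influence ν t f k := hf.expect_abs_sub_avg_le hν0 h1 k
      _ ≤ _ := by rw [mul_div_assoc]; linarith [hinf k]
  have hL2 : ∀ j : Fin n, expect ν ((f - avg ν j f) ^ 2) ≤ 2 * K / n := by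
    intro j
    calc _ ≤ expect ν (fun y => |f y - avg ν j f y|) := by
          refine expect_mono hν0 fun y => ?_
          have hp0 := avg_nonneg hν0 j hf0 y
          have hp1 : avg ν j f y ≤ 1 := by
            have := avg_nonneg hν0 j (g := (fun _ => 1) - f) (fun y => sub_nonneg.2 (hf1 y)) y
            rw [map_sub, avg_of_indepOf h1 (fun _ _ => rfl)] at this
            simpa using this
          have h3 : |f y - avg ν j f y| ≤ 1 := by
            rw [abs_le]
            constructor <;> linarith [hf0 y, hf1 y]
          simp only [Pi.pow_apply, Pi.sub_apply]
          rw [← sq_abs]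
          nlinarith [abs_nonneg (f y - avg ν j f y)]
      _ ≤ 2 * influence ν t f j := hf.expect_abs_sub_avg_le hν0 h1 j
      _ ≤ _ := by rw [mul_div_assoc]; linarith [hinf j]
  have hLS : ∑ k, ent ν ((d k) ^ 2) ≤ 8 * K / α := by
    calc _ ≤ ∑ k, 4 / α * ∑ j, expect ν ((d k - avg ν j (d k)) ^ 2) :=
          Finset.sum_le_sum fun k _ => ent_sq_le hα hν h1 (d k)
      _ = 4 / α * ∑ j, ∑ k, expect ν ((d k - avg ν j (d k)) ^ 2) := by
          rw [← Finset.mul_sum, Finset.sum_comm]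
      _ ≤ 4 / α * ∑ j : Fin n, 2 * K / n := by
          refine mul_le_mul_of_nonneg_left (Finset.sum_le_sum fun j _ => ?_) (by positivity)
          -- The martingale differences of `f - avg ν j f` are those of `f`, minus their averages.
          have e : ∀ k : Fin n, d k - avg ν j (d k) = avgBelow ν k (f - avg ν j f) -
              avg ν k (avgBelow ν k (f - avg ν j f)) := by
            intro k
            simp only [hd, map_sub, avgBelow_avg, avg_comm ν j k]
            abel
          rw [Finset.sum_congr rfl fun k _ => by rw [e k], sum_expect_sub_sq h1]
          exact (sub_le_self _ (sq_nonneg _)).trans (hL2 j)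
      _ = _ := by
          simp only [Finset.sum_const, Finset.card_univ, Fintype.card_fin, nsmul_eq_mul]
          field_simp
          ring
  have hLpos : 0 < 2 * K / n := by positivity
  have hlow := Finset.sum_le_sum fun k (_ : k ∈ Finset.univ) => le_ent_sq hν0 (d k) hLpos (hL1 k)
  have hsum : ∑ k, expect ν ((d k) ^ 2) = expect ν (f ^ 2) - (expect ν f) ^ 2 :=
    sum_expect_sub_sq h1 f
  set V := expect ν (f ^ 2) - (expect ν f) ^ 2 with hVdef
  have hVpos : 0 < V := hV₀.trans_le hV
  have hconv := mul_log_sum_le (v := fun k => expect ν ((d k) ^ 2))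
    (fun k => expect_nonneg hν0 fun y => sq_nonneg _) (by rw [hsum]; exact hVpos)
    (pow_pos hLpos 2)
  rw [hsum] at hconv
  have hmain : V * Real.log (V / n / (2 * K / n) ^ 2) ≤ 8 * K / α := (hconv.trans hlow).trans hLS
  by_contra hcon
  rw [not_le] at hcon
  have e : V / n / (2 * K / n) ^ 2 = V * n / (4 * K ^ 2) := by
    field_simp
    ring
  have h5 : 8 * K / (α * V₀) < Real.log (V * n / (4 * K ^ 2)) := by
    rw [Real.lt_log_iff_exp_lt (by positivity), lt_div_iff₀ (by positivity)]
    rw [div_mul_eq_mul_div, div_lt_iff₀ hV₀] at hcon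
    calc _ = 4 * K ^ 2 * Real.exp (8 * K / (α * V₀)) := by ring
      _ < n * V₀ := hcon
      _ ≤ V * n := by rw [mul_comm]; exact mul_le_mul_of_nonneg_right hV hn'.le
  rw [e] at hmain
  have h6 : 8 * K / α < V * Real.log (V * n / (4 * K ^ 2)) := by
    calc 8 * K / α = V₀ * (8 * K / (α * V₀)) := by field_simp
      _ ≤ V * (8 * K / (α * V₀)) := mul_le_mul_of_nonneg_right hV (by positivity)
      _ < _ := mul_lt_mul_of_pos_left h5 hVpos
  linarith

/-- Under a transitive group of symmetries all coordinates have the same influence. -/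
theorem influence_eq_of_transitive (ν : B → ℝ) (t : B) {f : (Fin n → B) → ℝ}
    {Γ : Subgroup (Equiv.Perm (Fin n))} (htrans : ∀ i j : Fin n, ∃ g ∈ Γ, g i = j)
    (hΓ : ∀ g ∈ Γ, ∀ y, f (y ∘ g) = f y) (i j : Fin n) :
    influence ν t f i = influence ν t f j := by
  obtain ⟨g, hg, rfl⟩ := htrans i j
  rw [influence, influence, sub_left_inj,
    ← expect_comp_perm ν g fun y => f (Function.update y i t)]
  congr 1
  ext y
  rw [← hΓ g hg (Function.update y (g i) t)]
  congr 1
  ext k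
  simp [Function.update_apply]

/-! ### Sharp thresholds -/

open Classical in
/-- The weights `ν` after each letter has been replaced by `t` with probability `x`. -/
noncomputable def tilt {A : Type*} (ν : A → ℝ) (t : A) (x : ℝ) (a : A) : ℝ :=
  (1 - x) * ν a + x * if a = t then 1 else 0

theorem tilt_zero {A : Type*} (ν : A → ℝ) (t : A) : tilt ν t 0 = ν := by
  ext a
  simp [tilt]

theorem sum_tilt {ν : B → ℝ} (h1 : ∑ a, ν a = 1) (t : B) (x : ℝ) : ∑ a, tilt ν t x a = 1 := by
  classical
  simp only [tilt, Finset.sum_add_distrib, ← Finset.mul_sum, h1, Finset.sum_ite_eq',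
    Finset.mem_univ, if_true]
  ring

/-- The Margulis–Russo formula: along the path `tilt ν t x`, the expectation of `f` grows at the
rate of the total influence towards `t`. -/
theorem hasDerivAt_expect_tilt {ν : B → ℝ} (h1 : ∑ a, ν a = 1) (t : B) (f : (Fin n → B) → ℝ)
    {x : ℝ} (hx : x < 1) :
    HasDerivAt (fun x => expect (tilt ν t x) f)
      ((∑ i, influence (tilt ν t x) t f i) / (1 - x)) x := by
  classical
  have hx' : (1 - x) ≠ 0 := by linarith
  set μ : B → ℝ := fun a => (if a = t then 1 else 0) - ν a with hμ
  have hd : ∀ a, HasDerivAt (fun x => tilt ν t x a) (μ a) x := by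
    intro a
    have h := (((hasDerivAt_id x).const_sub 1).mul_const (ν a)).add
      ((hasDerivAt_id x).mul_const (if a = t then (1 : ℝ) else 0))
    have e : (-1 : ℝ) * ν a + 1 * (if a = t then (1 : ℝ) else 0) = μ a := by
      simp only [hμ]
      ring
    rw [e] at h
    refine h.congr_of_eventuallyEq (Filter.Eventually.of_forall fun z => ?_)
    simp [tilt]
  have hp : HasDerivAt (fun x => expect (tilt ν t x) f)
      (∑ y : Fin n → B, (∑ i, (∏ j ∈ Finset.univ.erase i, tilt ν t x (y j)) • μ (y i)) * f y) x :=
    HasDerivAt.fun_sum fun y _ => (HasDerivAt.fun_finsetProd fun i _ => hd (y i)).mul_const (f y)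
  convert hp using 1
  have e : ∀ i, influence (tilt ν t x) t f i / (1 - x) = expect (tilt ν t x) (avg μ i f) := by
    intro i
    rw [influence, ← expect_avg (sum_tilt h1 t x) i f, ← map_sub, div_eq_inv_mul, ← smul_eq_mul,
      ← map_smul]
    congr 1
    ext y
    have e1 : avg μ i f y = f (Function.update y i t) - ∑ a, ν a * f (Function.update y i a) := by
      simp [avg_apply, hμ, sub_mul, Finset.sum_sub_distrib]
    have e2 : avg (tilt ν t x) i f y = (1 - x) * ∑ a, ν a * f (Function.update y i a) +
        x * f (Function.update y i t) := by
      simp [avg_apply, tilt, add_mul, Finset.sum_add_distrib, Finset.mul_sum, mul_assoc]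
    rw [e1]
    simp only [Pi.smul_apply, Pi.sub_apply, smul_eq_mul, e2]
    field_simp
    ring
  rw [Finset.sum_div, Finset.sum_congr rfl fun i _ => e i]
  simp only [expect_avg_eq (sum_tilt h1 t x), Finset.sum_mul, smul_eq_mul]
  rw [Finset.sum_comm]

/-- Let a monotone, symmetric choice rule `φ : Bⁿ → B` treat `s` and `t` alike, and let `t` be less
popular than `s`. Then `t` is unlikely to be chosen: otherwise, raising the popularity of `t` until
it ties with `s` would, for large `n`, make `t` chosen with probability more than `1/2`, because
the event that `t` is chosen has a sharp threshold. -/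
theorem expect_chosen_lt [DecidableEq B] {α ε δ : ℝ} (hα : 0 < α) (hε : 0 < ε) (hδ : 0 < δ)
    {ν : B → ℝ} (hν : ∀ a, α ≤ ν a) (h1 : ∑ a, ν a = 1) {s t : B} (hst : ν t + ε ≤ ν s)
    {φ : (Fin n → B) → B} (hmono : ∀ y i, φ y = t → φ (Function.update y i t) = t)
    {Γ : Subgroup (Equiv.Perm (Fin n))} (htrans : ∀ i j : Fin n, ∃ g ∈ Γ, g i = j)
    (hΓ : ∀ g ∈ Γ, ∀ y, φ (y ∘ g) = φ y)
    (hswap : ∀ y, φ (Equiv.swap s t ∘ y) = Equiv.swap s t (φ y)) (hn : 0 < n)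
    (hN : 4 * (2 / ε) ^ 2 / (δ / 2) * Real.exp (8 * (2 / ε) / (α / 2 * (δ / 2))) < n) :
    expect ν (fun y => if φ y = t then 1 else 0) < δ := by
  by_contra! hcon
  have hne : s ≠ t := by
    rintro rfl
    linarith
  have hν0 : ∀ a, 0 ≤ ν a := fun a => hα.le.trans (hν a)
  have hn' : (0 : ℝ) < n := by exact_mod_cast hn
  set f : (Fin n → B) → ℝ := fun y => if φ y = t then 1 else 0 with hfdef
  have hf : IsMonotoneEvent t f := by
    refine ⟨fun y => ?_, fun y i => ?_⟩
    · by_cases h : φ y = t <;> simp [hfdef, h]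
    · by_cases h : φ y = t
      · simp [hfdef, h, hmono y i h]
      · simp only [hfdef, h, if_false]
        positivity
  set D := ν s - ν t with hD
  have hD0 : ε ≤ D := by linarith
  have hD1 : D ≤ 1 := by
    have := Finset.single_le_sum (f := ν) (fun b _ => hν0 b) (Finset.mem_univ s)
    linarith [hν0 t]
  -- the point of the path at which `s` and `t` tie
  set x₁ := D / (1 + D) with hx₁
  have hx₁ε : ε / 2 ≤ x₁ := by
    rw [hx₁, le_div_iff₀ (by linarith)]
    nlinarith
  have hx₁h : x₁ ≤ 1 / 2 := by
    rw [hx₁, div_le_iff₀ (by linarith)]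
    linarith
  have hx₁0 : 0 < x₁ := by linarith
  have htilt : ∀ x, 0 ≤ x → x ≤ x₁ → ∀ a, α / 2 ≤ tilt ν t x a := by
    intro x hx0 hx a
    have h2 : (1 / 2) * α ≤ (1 - x) * ν a :=
      mul_le_mul (by linarith) (hν a) hα.le (by linarith)
    rw [tilt]
    split_ifs <;> linarith
  have hder : ∀ x, x ≤ x₁ → HasDerivAt (fun x => expect (tilt ν t x) f)
      ((∑ i, influence (tilt ν t x) t f i) / (1 - x)) x := fun x hx =>
    hasDerivAt_expect_tilt h1 t f (by linarith)
  have hmon : MonotoneOn (fun x => expect (tilt ν t x) f) (Set.Icc 0 x₁) := by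
    refine monotoneOn_of_hasDerivWithinAt_nonneg
      (f' := fun x => (∑ i, influence (tilt ν t x) t f i) / (1 - x)) (convex_Icc 0 x₁)
      (fun x hx => (hder x hx.2).continuousAt.continuousWithinAt) (fun x hx => ?_) fun x hx => ?_
    · rw [interior_Icc] at hx
      exact (hder x hx.2.le).hasDerivWithinAt
    · rw [interior_Icc] at hx
      refine div_nonneg (Finset.sum_nonneg fun i _ => hf.influence_nonneg (fun a => ?_) i) ?_
      · have := htilt x hx.1.le hx.2.le a
        linarith
      · linarith [hx.2]
  have hhalf : expect (tilt ν t x₁) f ≤ 1 / 2 := by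
    set ν₁ := tilt ν t x₁ with hν₁
    have htie : ν₁ s = ν₁ t := by
      have : (1 : ℝ) + D ≠ 0 := by linarith
      simp only [hν₁, tilt, if_neg hne, if_true, hx₁]
      field_simp
      rw [hD]
      ring
    have hσ : ∀ a, ν₁ (Equiv.swap s t a) = ν₁ a := by
      intro a
      rcases eq_or_ne a s with rfl | has
      · rw [Equiv.swap_apply_left, htie]
      rcases eq_or_ne a t with rfl | hat
      · rw [Equiv.swap_apply_right, htie]
      · rw [Equiv.swap_apply_of_ne_of_ne has hat]
    have h2 := expect_comp_letters (n := n) _ hσ f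
    have h3 := expect_mono (fun a => (half_pos hα).le.trans (htilt x₁ hx₁0.le le_rfl a))
      (g := (fun y => f (Equiv.swap s t ∘ y)) + f) (h := fun _ => 1) (fun y => by
        simp only [Pi.add_apply, hfdef, hswap]
        by_cases h : φ y = t
        · simp [h, hne]
        · by_cases h' : Equiv.swap s t (φ y) = t <;> simp [h, h'])
    rw [map_add, h2, expect_const (sum_tilt h1 t x₁)] at h3
    linarith
  obtain ⟨x, hx, hslope⟩ := exists_hasDerivAt_eq_slope (fun x => expect (tilt ν t x) f) _ hx₁0
    (fun x hx => (hder x hx.2).continuousAt.continuousWithinAt) (fun x hx => hder x hx.2.le)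
  have hνx := htilt x hx.1.le hx.2.le
  have hνx0 : ∀ a, 0 ≤ tilt ν t x a := fun a => (half_pos hα).le.trans (hνx a)
  have hlo : δ ≤ expect (tilt ν t x) f := by
    have := hmon ⟨le_rfl, hx₁0.le⟩ ⟨hx.1.le, hx.2.le⟩ hx.1.le
    simp only [tilt_zero] at this
    exact hcon.trans this
  have hhi : expect (tilt ν t x) f ≤ 1 / 2 :=
    (hmon ⟨hx.1.le, hx.2.le⟩ ⟨hx₁0.le, le_rfl⟩ hx.2.le).trans hhalf
  have hV : δ / 2 ≤ expect (tilt ν t x) (f ^ 2) - (expect (tilt ν t x) f) ^ 2 := by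
    have : f ^ 2 = f := by
      ext y
      rcases hf.zero_or_one y with h | h <;> simp [h]
    rw [this]
    nlinarith
  have hsum : ∑ i, influence (tilt ν t x) t f i ≤ 2 / ε := by
    have hpos : 0 ≤ ∑ i, influence (tilt ν t x) t f i :=
      Finset.sum_nonneg fun i _ => hf.influence_nonneg hνx0 i
    have h2 : (∑ i, influence (tilt ν t x) t f i) ≤
        (∑ i, influence (tilt ν t x) t f i) / (1 - x) := by
      rw [le_div_iff₀ (by linarith [hx.2])]
      nlinarith [hx.1]
    have h3 : 0 ≤ expect (tilt ν t 0) f := by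
      rw [tilt_zero]
      exact hδ.le.trans hcon
    refine h2.trans ?_
    rw [hslope, div_le_div_iff₀ (by linarith) hε]
    nlinarith
  have hinf : ∀ i, influence (tilt ν t x) t f i ≤ 2 / ε / n := by
    intro i
    have e : ∑ j, influence (tilt ν t x) t f j = n * influence (tilt ν t x) t f i := by
      rw [Finset.sum_congr rfl fun j _ => influence_eq_of_transitive (tilt ν t x) t htrans
        (fun g hg y => by simp only [hfdef, hΓ g hg y]) j i]
      simp
    rw [le_div_iff₀ hn', mul_comm, ← e]
    exact hsum
  exact absurd (hf.card_le_of_influence_le (half_pos hα) hνx (sum_tilt h1 t x) hn (by positivity)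
    (half_pos hδ) hV hinf) (not_le.2 hN)

/-! ### Image weights -/

open Classical in
/-- The image of the weights `ν` under `π`. -/
noncomputable def mapWeights {A B : Type*} [Fintype A] (ν : A → ℝ) (π : A → B) (b : B) : ℝ :=
  ∑ a, ν a * if π a = b then 1 else 0

theorem sum_mapWeights {A B : Type*} [Fintype A] [Fintype B] (ν : A → ℝ) (π : A → B) :
    ∑ b, mapWeights ν π b = ∑ a, ν a := by
  classical
  simp only [mapWeights]
  rw [Finset.sum_comm]
  simp only [← Finset.mul_sum, Finset.sum_ite_eq, Finset.mem_univ, if_true, mul_one]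

/-- The expectation of a function of `π (p 1), …, π (p n)` may be computed with the image weights
under `π`. -/
theorem expect_comp_map {A B : Type*} [Fintype A] [Fintype B] (ν : A → ℝ) (π : A → B)
    (h : (Fin n → B) → ℝ) :
    expect ν (fun p => h fun i => π (p i)) =
      expect (mapWeights ν π) h := by
  classical
  rw [expect_apply, expect_apply,
    ← Finset.sum_fiberwise Finset.univ fun (p : Fin n → A) i => π (p i)]
  refine Finset.sum_congr rfl fun y _ => ?_
  have e1 : (Finset.univ.filter fun p : Fin n → A => (fun i => π (p i)) = y) =
      Fintype.piFinset fun i => Finset.univ.filter fun a => π a = y i := by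
    ext p
    simp [Fintype.mem_piFinset, funext_iff]
  have e2 : ∀ b, mapWeights ν π b = ∑ a ∈ Finset.univ.filter (fun a => π a = b), ν a := by
    intro b
    simp [mapWeights, Finset.sum_filter]
  simp only [e2]
  rw [Finset.prod_univ_sum, ← e1, Finset.sum_mul]
  refine Finset.sum_congr rfl fun p hp => ?_
  rw [(Finset.mem_filter.1 hp).2]

end SharpThreshold

namespace SocialChoice

variable {X : Type*}

/-! ### Rankings with one alternative lifted -/

theorem ChoiceFunction.finite [Finite X] : Finite (ChoiceFunction X) :=
  Finite.of_injective ChoiceFunction.pick fun _ _ h => ChoiceFunction.ext h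

noncomputable instance [Finite X] : Fintype (RationalChoice X) :=
  have := ChoiceFunction.finite (X := X)
  Fintype.ofFinite _

/-- The rational choice function that picks the alternative with the largest value of `f`. -/
noncomputable def maximizer (f : X → ℕ) (hf : Function.Injective f) : RationalChoice X where
  val :=
    { pick := fun S => (S.1.exists_max_image f S.2).choose
      pick_mem := fun S => (S.1.exists_max_image f S.2).choose_spec.1 }
  property := ⟨LinearOrder.lift' f hf, fun S a ha =>
    (S.1.exists_max_image f S.2).choose_spec.2 a ha⟩

theorem le_maximizer_pick (f : X → ℕ) (hf : Function.Injective f) (S : NonemptySubset X) {a : X}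
    (ha : a ∈ S.1) : f a ≤ f ((maximizer f hf).1.pick S) :=
  (S.1.exists_max_image f S.2).choose_spec.2 a ha

theorem maximizer_pick_eq (f : X → ℕ) (hf : Function.Injective f) (S : NonemptySubset X) {x : X}
    (hx : x ∈ S.1) (h : ∀ a ∈ S.1, f a ≤ f x) : (maximizer f hf).1.pick S = x :=
  hf (le_antisymm (h _ ((maximizer f hf).1.pick_mem S)) (le_maximizer_pick f hf S hx))

open Classical in
/-- A score that ranks the alternatives outside `S` on top and the other alternatives of `S` below
them, and gives `s` the score `j`. For `j = 0` the alternative `s` comes last; for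
`j = card X + 1` it comes first in `S`, all other comparisons being unchanged. -/
noncomputable def liftScore [Fintype X] (S : Finset X) (s : X) (j : ℕ) (x : X) : ℕ :=
  if x = s then j else if x ∈ S then (Fintype.equivFin X x : ℕ) + 1
    else (Fintype.equivFin X x : ℕ) + (Fintype.card X + 2)

theorem liftScore_injective [Fintype X] (S : Finset X) (s : X) {j : ℕ}
    (hj : j = 0 ∨ j = Fintype.card X + 1) : Function.Injective (liftScore S s j) := by
  intro x y h
  have hx := (Fintype.equivFin X x).2
  have hy := (Fintype.equivFin X y).2
  simp only [liftScore] at h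
  by_cases h1 : x = s <;> by_cases h2 : y = s
  · rw [h1, h2]
  all_goals
    by_cases h3 : x ∈ S <;> by_cases h4 : y ∈ S <;>
      simp only [h1, h2, h3, h4, if_true, if_false] at h
  all_goals first
    | omega
    | exact (Fintype.equivFin X).injective (Fin.ext (by omega))

/-- All alternatives outside `S` come first, then `S`, with `s` in the last place. -/
noncomputable def lowRanking [Fintype X] (S : Finset X) (s : X) : RationalChoice X :=
  maximizer (liftScore S s 0) (liftScore_injective S s (Or.inl rfl))

/-- `lowRanking S s` with `s` moved up to the first place in `S`. -/
noncomputable def highRanking [Fintype X] (S : Finset X) (s : X) : RationalChoice X :=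
  maximizer (liftScore S s (Fintype.card X + 1)) (liftScore_injective S s (Or.inr rfl))

/-- Moving `s` up changes a choice only by making it `s`. -/
theorem lowRanking_pick_eq [Fintype X] {S₀ : Finset X} {s : X} {S : NonemptySubset X}
    (h : (highRanking S₀ s).1.pick S ≠ s) :
    (lowRanking S₀ s).1.pick S = (highRanking S₀ s).1.pick S := by
  refine maximizer_pick_eq _ _ S ((highRanking S₀ s).1.pick_mem S) fun a ha => ?_
  have h1 : liftScore S₀ s _ a ≤ liftScore S₀ s _ ((highRanking S₀ s).1.pick S) :=
    le_maximizer_pick _ (liftScore_injective S₀ s (Or.inr rfl)) S ha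
  simp only [liftScore, h, if_false] at h1 ⊢
  by_cases h2 : a = s
  · simp [h2]
  · simpa only [h2, if_false] using h1

/-- The two rankings choose differently only on subsets of `S₀`. -/
theorem lowRanking_pick_eq_of_not_subset [Fintype X] {S₀ : Finset X} {s : X}
    {S : NonemptySubset X} (h : ¬ S.1 ⊆ S₀) (hs : s ∈ S₀) :
    (lowRanking S₀ s).1.pick S = (highRanking S₀ s).1.pick S := by
  refine lowRanking_pick_eq fun h1 => ?_
  obtain ⟨z, hz, hz0⟩ := Finset.not_subset.1 h
  have hzs : z ≠ s := by
    rintro rfl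
    exact hz0 hs
  have h2 : liftScore S₀ s _ z ≤ liftScore S₀ s _ ((highRanking S₀ s).1.pick S) :=
    le_maximizer_pick _ (liftScore_injective S₀ s (Or.inr rfl)) S hz
  rw [h1] at h2
  simp only [liftScore, if_true, hzs, hz0, if_false] at h2
  omega

theorem highRanking_pick [Fintype X] {S : NonemptySubset X} {s : X} (hs : s ∈ S.1) :
    (highRanking S.1 s).1.pick S = s := by
  refine maximizer_pick_eq _ _ S hs fun a ha => ?_
  have := (Fintype.equivFin X a).2
  by_cases h2 : a = s
  · simp [h2]
  · simp only [liftScore, h2, ha, if_true, if_false]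
    omega

theorem lowRanking_pick_ne [Fintype X] {S : NonemptySubset X} {s t : X} (ht : t ∈ S.1)
    (hts : t ≠ s) : (lowRanking S.1 s).1.pick S ≠ s := by
  intro h
  have h2 : liftScore S.1 s _ t ≤ liftScore S.1 s _ ((lowRanking S.1 s).1.pick S) :=
    le_maximizer_pick _ (liftScore_injective S.1 s (Or.inl rfl)) S ht
  rw [h] at h2
  simp only [liftScore, if_true, hts, ht, if_false] at h2
  omega

theorem exists_pick_eq [Fintype X] {S : NonemptySubset X} {s : X} (hs : s ∈ S.1) :
    ∃ r : RationalChoice X, r.1.pick S = s :=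
  ⟨_, highRanking_pick hs⟩

/-! ### Exchanging two alternatives -/

section Swap

variable [DecidableEq X]

theorem NonemptySubset.permute_swap_inv {S : NonemptySubset X} {s t : X} (hs : s ∈ S.1)
    (ht : t ∈ S.1) : S.permute (Equiv.swap s t)⁻¹ = S := by
  refine Subtype.ext (Finset.ext fun x => ?_)
  have key : ∀ x ∈ S.1, Equiv.swap s t x ∈ S.1 := by
    intro x hx
    rcases eq_or_ne x s with rfl | hxs
    · rwa [Equiv.swap_apply_left]
    rcases eq_or_ne x t with rfl | hxt
    · rwa [Equiv.swap_apply_right]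
    · rwa [Equiv.swap_apply_of_ne_of_ne hxs hxt]
  simp only [NonemptySubset.permute, Finset.mem_map, Equiv.swap_inv, Equiv.coe_toEmbedding]
  constructor
  · rintro ⟨y, hy, rfl⟩
    exact key y hy
  · intro hx
    exact ⟨_, key x hx, Equiv.swap_apply_self _ _ _⟩

theorem ChoiceFunction.permute_swap_pick (c : ChoiceFunction X) {S : NonemptySubset X} {s t : X}
    (hs : s ∈ S.1) (ht : t ∈ S.1) :
    (c.permute (Equiv.swap s t)).pick S = Equiv.swap s t (c.pick S) := by
  change Equiv.swap s t (c.pick (S.permute (Equiv.swap s t)⁻¹)) = _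
  rw [NonemptySubset.permute_swap_inv hs ht]

theorem RationalChoice.permute_swap_involutive (s t : X) :
    Function.Involutive (RationalChoice.permute (Equiv.swap s t)) := by
  intro r
  refine Subtype.ext (ChoiceFunction.ext (funext fun S => ?_))
  have e : (S.permute (Equiv.swap s t)⁻¹).permute (Equiv.swap s t)⁻¹ = S := by
    refine Subtype.ext ?_
    simp only [NonemptySubset.permute, Finset.map_map, Equiv.swap_inv]
    have : (Equiv.swap s t).toEmbedding.trans (Equiv.swap s t).toEmbedding =
        Function.Embedding.refl X := by
      ext x
      simp
    rw [this, Finset.map_refl]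
  simp only [RationalChoice.permute, ChoiceFunction.permute, e, Equiv.swap_apply_self]

end Swap

/-! ### Weights with prescribed plurality choices -/

open Classical in
/-- The total weight of the rational choice functions that choose `t` from `S`. -/
noncomputable def score [Finite X] (W : RationalChoice X → ℝ) (S : NonemptySubset X) (t : X) : ℝ :=
  ∑ r, W r * if r.1.pick S = t then 1 else 0

/-- Under equal weights any two alternatives of `S` tie on `S`. -/
theorem score_const_eq [Finite X] (C : ℝ) {S : NonemptySubset X} {s t : X} (hs : s ∈ S.1)
    (ht : t ∈ S.1) : score (fun _ => C) S s = score (fun _ => C) S t := by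
  classical
  refine Fintype.sum_equiv ((RationalChoice.permute_swap_involutive s t).toPerm _) _ _ fun r => ?_
  have e : (((RationalChoice.permute_swap_involutive s t).toPerm _) r).1.pick S =
      Equiv.swap s t (r.1.pick S) := r.1.permute_swap_pick hs ht
  rw [e]
  have : Equiv.swap s t (r.1.pick S) = t ↔ r.1.pick S = s := by
    rw [Equiv.swap_apply_eq_iff, Equiv.swap_apply_right]
  simp only [this]

theorem card_nonemptySubset_le [Fintype X] :
    Fintype.card (NonemptySubset X) ≤ 2 ^ Fintype.card X := by
  rw [← Fintype.card_finset]
  exact Fintype.card_subtype_le _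

theorem card_rationalChoice_le [Fintype X] :
    Fintype.card (RationalChoice X) ≤ (Fintype.card X + 1) ^ 2 ^ Fintype.card X := by
  classical
  have h1 : Fintype.card (RationalChoice X) ≤ Fintype.card (NonemptySubset X → X) :=
    Fintype.card_le_of_injective (fun r => r.1.pick) fun _ _ h =>
      Subtype.ext (ChoiceFunction.ext h)
  rw [Fintype.card_fun] at h1
  calc _ ≤ _ := h1
    _ ≤ (Fintype.card X + 1) ^ Fintype.card (NonemptySubset X) :=
      Nat.pow_le_pow_left (Nat.le_succ _) _
    _ ≤ _ := Nat.pow_le_pow_right (Nat.succ_pos _) card_nonemptySubset_le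

/-- Every choice function is the strict plurality choice, on all sets at once, for some weights on
the rational choice functions; the total weight is bounded in terms of `m`.

Exchanging a little weight from `lowRanking S (c S)` to `highRanking S (c S)` makes `c S` win on `S`
and affects only subsets of `S`. Doing this for all `S`, with weights that grow fast as `S`
shrinks, starting from equal weights, gives the result. -/
theorem exists_plurality_weights (m : ℕ) :
    ∃ T : ℝ, 0 < T ∧ ∀ (X : Type*) [Fintype X], Fintype.card X = m → ∀ c : ChoiceFunction X,
      ∃ W : RationalChoice X → ℝ, (∀ r, 1 ≤ W r) ∧ ∑ r, W r ≤ T ∧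
        ∀ (S : NonemptySubset X) (t : X), t ∈ S.1 → t ≠ c.pick S →
          score W S t + 1 ≤ score W S (c.pick S) := by
  classical
  set K : ℝ := 4 * 2 ^ m with hK
  have hK1 : 1 ≤ K := by
    have : (1 : ℝ) ≤ 2 ^ m := one_le_pow₀ (by norm_num)
    linarith
  have hK0 : 0 < K := by linarith
  refine ⟨(1 + 2 ^ m * (2 * K ^ m)) * (m + 1 : ℝ) ^ 2 ^ m, by positivity, fun X _ hX c => ?_⟩
  have hcard : (Fintype.card (NonemptySubset X) : ℝ) ≤ 2 ^ m := by
    have h := card_nonemptySubset_le (X := X)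
    rw [hX] at h
    exact_mod_cast h
  let w : NonemptySubset X → ℝ := fun S => 2 * K ^ (m - S.1.card)
  have hw0 : ∀ S, 0 < w S := fun S => by positivity
  have hw1 : ∀ S, 2 ≤ w S := fun S => by
    have : (1 : ℝ) ≤ K ^ (m - S.1.card) := one_le_pow₀ hK1
    simp only [w]
    linarith
  have hwm : ∀ S, w S ≤ 2 * K ^ m := fun S => by
    have : K ^ (m - S.1.card) ≤ K ^ m := pow_le_pow_right₀ hK1 (Nat.sub_le _ _)
    simp only [w]
    linarith
  set C : ℝ := 1 + ∑ S, w S with hC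
  have hCm : C ≤ 1 + 2 ^ m * (2 * K ^ m) := by
    have h := Finset.sum_le_card_nsmul Finset.univ w _ fun S _ => hwm S
    rw [nsmul_eq_mul, Finset.card_univ] at h
    have h2 : (Fintype.card (NonemptySubset X) : ℝ) * (2 * K ^ m) ≤ 2 ^ m * (2 * K ^ m) :=
      mul_le_mul_of_nonneg_right hcard (by positivity)
    linarith
  let hi : NonemptySubset X → RationalChoice X := fun S => highRanking S.1 (c.pick S)
  let lo : NonemptySubset X → RationalChoice X := fun S => lowRanking S.1 (c.pick S)
  let D : RationalChoice X → ℝ := fun r =>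
    ∑ S, w S * ((if r = hi S then 1 else 0) - if r = lo S then 1 else 0)
  -- the change that the exchange for `S₀` makes to the score of `t` on `S`
  let E : NonemptySubset X → NonemptySubset X → X → ℝ := fun S₀ S t =>
    (if (hi S₀).1.pick S = t then 1 else 0) - if (lo S₀).1.pick S = t then 1 else 0
  have hscore : ∀ S t, score (fun r => C + D r) S t =
      score (fun _ => C) S t + ∑ S₀, w S₀ * E S₀ S t := by
    intro S t
    have h : ∀ r, (C + D r) * (if r.1.pick S = t then 1 else 0) =
        C * (if r.1.pick S = t then 1 else 0) + ∑ S₀, w S₀ *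
          ((if r = hi S₀ then (if r.1.pick S = t then 1 else 0) else 0) -
            if r = lo S₀ then (if r.1.pick S = t then 1 else 0) else 0) := by
      intro r
      rw [add_mul, Finset.sum_mul]
      congr 1
      refine Finset.sum_congr rfl fun S₀ _ => ?_
      split_ifs <;> ring
    rw [score, Finset.sum_congr rfl fun r _ => h r, Finset.sum_add_distrib, Finset.sum_comm]
    congr 1
    refine Finset.sum_congr rfl fun S₀ _ => ?_
    rw [← Finset.mul_sum, Finset.sum_sub_distrib, Finset.sum_ite_eq', Finset.sum_ite_eq',
      if_pos (Finset.mem_univ _), if_pos (Finset.mem_univ _)]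
  refine ⟨fun r => C + D r, fun r => ?_, ?_, fun S t ht hts => ?_⟩
  · have : -∑ S, w S ≤ D r := by
      rw [← Finset.sum_neg_distrib]
      refine Finset.sum_le_sum fun S _ => ?_
      have := hw0 S
      split_ifs <;> linarith
    linarith
  · have hD : ∑ r, D r = 0 := by
      simp only [D]
      rw [Finset.sum_comm]
      refine Finset.sum_eq_zero fun S _ => ?_
      rw [← Finset.mul_sum, Finset.sum_sub_distrib, Finset.sum_ite_eq', Finset.sum_ite_eq',
        if_pos (Finset.mem_univ _), if_pos (Finset.mem_univ _), sub_self, mul_zero]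
    have hA : (Fintype.card (RationalChoice X) : ℝ) ≤ (m + 1 : ℝ) ^ 2 ^ m := by
      have := card_rationalChoice_le (X := X)
      rw [hX] at this
      exact_mod_cast this
    rw [Finset.sum_add_distrib, hD, Finset.sum_const, nsmul_eq_mul, Finset.card_univ, add_zero,
      mul_comm]
    exact mul_le_mul hCm hA (by positivity) (by positivity)
  · have hs := c.pick_mem S
    rw [hscore, hscore, score_const_eq C ht hs]
    have hterm : ∀ S₀, (if S₀ = S then w S else 0) - 2 * w S / K ≤
        w S₀ * E S₀ S (c.pick S) - w S₀ * E S₀ S t := by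
      intro S₀
      have hpos : 0 < 2 * w S / K := div_pos (by linarith [hw0 S]) hK0
      rcases eq_or_ne S₀ S with rfl | hne
      · have h1 : (hi S₀).1.pick S₀ = c.pick S₀ := highRanking_pick hs
        have h2 : (lo S₀).1.pick S₀ ≠ c.pick S₀ := lowRanking_pick_ne ht hts
        simp only [E, h1, h2, hts.symm, if_true, if_false]
        have := hw0 S₀
        split_ifs <;> linarith
      rw [if_neg hne]
      by_cases hsub : S.1 ⊆ S₀.1
      · have hlt : S.1.card < S₀.1.card :=
          Finset.card_lt_card (hsub.ssubset_of_ne fun h => hne (Subtype.ext h.symm))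
        have hle : S₀.1.card ≤ m := hX ▸ Finset.card_le_univ _
        have hwle : w S₀ ≤ w S / K := by
          rw [le_div_iff₀ hK0]
          simp only [w]
          rw [mul_assoc, ← pow_succ]
          exact mul_le_mul_of_nonneg_left (pow_le_pow_right₀ hK1 (by omega)) (by norm_num)
        have h0 := hw0 S₀
        rw [mul_div_assoc]
        have h3 : w S₀ * -2 ≤ w S₀ * (E S₀ S (c.pick S) - E S₀ S t) := by
          refine mul_le_mul_of_nonneg_left ?_ h0.le
          simp only [E]
          split_ifs <;> linarith
        linarith
      · have h1 : (lo S₀).1.pick S = (hi S₀).1.pick S :=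
          lowRanking_pick_eq_of_not_subset hsub (c.pick_mem S₀)
        simp only [E, h1, sub_self]
        linarith
    have h := Finset.sum_le_sum fun S₀ (_ : S₀ ∈ Finset.univ) => hterm S₀
    rw [Finset.sum_sub_distrib, Finset.sum_sub_distrib, Finset.sum_ite_eq',
      if_pos (Finset.mem_univ _), Finset.sum_const, nsmul_eq_mul, Finset.card_univ] at h
    have h2 : (Fintype.card (NonemptySubset X) : ℝ) * (2 * w S / K) ≤ w S / 2 := by
      calc _ ≤ 2 ^ m * (2 * w S / K) :=
            mul_le_mul_of_nonneg_right hcard (div_nonneg (by linarith [hw0 S]) hK0.le)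
        _ = _ := by
            rw [hK]
            field_simp
            ring
    have := hw1 S
    linarith

/-! ### Social choice from a random profile -/

open Classical in
/-- Weights for which each alternative of `S` other than `s` is less popular on `S` than `s` make
it unlikely that society chooses such an alternative from `S`. -/
theorem expect_pick_lt {n : ℕ} [Fintype X] {F : SocialChoiceFunction n X} (hI : F.IRA)
    (hN : F.Neutral) (hA : F.WeaklyAnonymous) (hM : F.Monotone) {α δ : ℝ} (hα : 0 < α)
    (hδ : 0 < δ) {ν : RationalChoice X → ℝ} (hν : ∀ r, α ≤ ν r) (h1 : ∑ r, ν r = 1)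
    {S : NonemptySubset X} {s t : X} (hs : s ∈ S.1) (ht : t ∈ S.1)
    (hst : score ν S t + α ≤ score ν S s) (hn : 0 < n)
    (hlarge : 4 * (2 / α) ^ 2 / (δ / 2) * Real.exp (8 * (2 / α) / (α / 2 * (δ / 2))) < n) :
    SharpThreshold.expect ν (fun p : Profile n X => if (F p).pick S = t then 1 else 0) < δ := by
  choose r hr using fun b : S.1 => exists_pick_eq (S := S) b.2
  -- By independence of rejected alternatives, `F` acts on `S` through a rule `Sⁿ → S`.
  let φ : (Fin n → S.1) → S.1 := fun y => ⟨(F fun i => r (y i)).pick S, (F _).pick_mem S⟩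
  let π : RationalChoice X → S.1 := fun q => ⟨q.1.pick S, q.1.pick_mem S⟩
  obtain ⟨Γ, htrans, hΓ⟩ := hA
  have hφ : ∀ p : Profile n X, (F p).pick S = t ↔ φ (fun i => π (p i)) = ⟨t, ht⟩ := by
    intro p
    rw [Subtype.ext_iff]
    simp only [φ]
    rw [hI S p (fun i => r (π (p i))) fun i => (hr (π (p i))).symm]
  have hmap : SharpThreshold.mapWeights ν π = fun b : S.1 => score ν S b.1 := by
    ext b
    refine Finset.sum_congr rfl fun q _ => ?_
    simp only [π, Subtype.ext_iff]
  have hν0 : ∀ q, 0 ≤ ν q := fun q => hα.le.trans (hν q)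
  rw [show (fun p : Profile n X => if (F p).pick S = t then (1 : ℝ) else 0) =
    fun p => if φ (fun i => π (p i)) = ⟨t, ht⟩ then 1 else 0 from
      funext fun p => if_congr (hφ p) rfl rfl]
  rw [SharpThreshold.expect_comp_map ν π fun y => if φ y = ⟨t, ht⟩ then 1 else 0,
    hmap]
  refine SharpThreshold.expect_chosen_lt (ν := fun b : S.1 => score ν S b.1) (s := ⟨s, hs⟩)
    (t := ⟨t, ht⟩) (φ := φ) (Γ := Γ) hα hα hδ (fun b => ?_) ?_ hst ?_
    htrans (fun g hg y => Subtype.ext ?_) (fun y => Subtype.ext ?_) hn hlarge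
  · have h2 := Finset.single_le_sum
      (f := fun q : RationalChoice X => ν q * if q.1.pick S = b.1 then (1 : ℝ) else 0)
      (fun q _ => mul_nonneg (hν0 q) (by positivity)) (Finset.mem_univ (r b))
    simp only [hr b, if_true, mul_one] at h2
    exact (hν _).trans h2
  · rw [← h1, ← SharpThreshold.sum_mapWeights ν π, hmap]
  · intro y i hy
    have hy' : (F fun i => r (y i)).pick S = t := congrArg Subtype.val hy
    refine Subtype.ext ?_
    by_cases hyi : y i = ⟨t, ht⟩
    · rw [← hyi, Function.update_eq_self, hyi]
      exact hy'
    · have e : (fun j => r (Function.update y i ⟨t, ht⟩ j)) =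
          Function.update (fun j => r (y j)) i (r ⟨t, ht⟩) := by
        ext1 j
        rcases eq_or_ne j i with rfl | hji
        · simp
        · simp [Function.update_of_ne hji]
      have h3 := hM S (fun j => r (y j)) i (r ⟨t, ht⟩)
        (by
          rw [hr, hy']
          exact fun h => hyi (Subtype.ext h))
        (by rw [hr, hy'])
      simp only [φ]
      rw [e, h3, hy']
  · exact congrArg (fun c => c.pick S) (hΓ g hg fun i => r (y i))
  · have hval : ∀ b : S.1, (Equiv.swap (⟨s, hs⟩ : S.1) ⟨t, ht⟩ b).1 = Equiv.swap s t b.1 := by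
      intro b
      simp only [Equiv.swap_apply_def, Subtype.ext_iff]
      split_ifs <;> rfl
    have h3 : (F fun i => (r (y i)).permute (Equiv.swap s t)).pick S =
        Equiv.swap s t ((F fun i => r (y i)).pick S) := by
      rw [hN, ChoiceFunction.permute_swap_pick _ hs ht]
    rw [hval]
    refine Eq.trans (hI S _ _ fun i => ?_) h3
    rw [hr, Function.comp_apply, hval]
    refine Eq.trans ?_ ((r (y i)).1.permute_swap_pick hs ht).symm
    rw [hr]

end SocialChoice

theorem mainTheorem7 (m : ℕ) :
    ∃ N : ℕ, ∀ n : ℕ, N < n →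
      ∀ (X : Type*) [Fintype X], Fintype.card X = m →
        ∀ (c : SocialChoice.ChoiceFunction X) (F : SocialChoice.SocialChoiceFunction n X),
          F.IRA → F.Pareto → F.Neutral → F.WeaklyAnonymous → F.Monotone →
            ∃ p : SocialChoice.Profile n X, F p = c := by
  obtain ⟨T, hT, hW⟩ := SocialChoice.exists_plurality_weights m
  set α : ℝ := T⁻¹ with hα
  -- small enough for a union bound over all pairs of a nonempty subset and an alternative
  set δ : ℝ := 1 / (2 ^ m * m + 1) with hδ
  have hα0 : 0 < α := by positivity
  have hδ0 : 0 < δ := by positivity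
  refine ⟨⌈4 * (2 / α) ^ 2 / (δ / 2) * Real.exp (8 * (2 / α) / (α / 2 * (δ / 2)))⌉₊,
    fun n hn X _ hX c F hI _ hN hA hM => ?_⟩
  classical
  obtain ⟨W, hW1, hWT, hWS⟩ := hW X hX c
  obtain ⟨q₀⟩ : Nonempty (SocialChoice.RationalChoice X) :=
    ⟨SocialChoice.maximizer (fun x => (Fintype.equivFin X x : ℕ))
      (Fin.val_injective.comp (Fintype.equivFin X).injective)⟩
  have hW0 : 0 < ∑ r, W r :=
    Finset.sum_pos (fun r _ => zero_lt_one.trans_le (hW1 r)) ⟨q₀, Finset.mem_univ _⟩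
  have hαW : α ≤ 1 / ∑ r, W r := by
    rw [hα, ← one_div]
    exact one_div_le_one_div_of_le hW0 hWT
  set ν : SocialChoice.RationalChoice X → ℝ := fun r => W r / ∑ r, W r with hν
  have hνα : ∀ r, α ≤ ν r := fun r => hαW.trans (div_le_div_of_nonneg_right (hW1 r) hW0.le)
  have hν1 : ∑ r, ν r = 1 := by
    rw [hν, ← Finset.sum_div, div_self hW0.ne']
  have hscore : ∀ S t, SocialChoice.score ν S t = SocialChoice.score W S t / ∑ r, W r := by
    intro S t
    simp only [SocialChoice.score, hν]
    rw [Finset.sum_div]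
    exact Finset.sum_congr rfl fun r _ => by ring
  have hn0 : 0 < n := (Nat.zero_le _).trans_lt hn
  have hbad : ∀ (S : SocialChoice.NonemptySubset X) (t : X), SharpThreshold.expect ν
      (fun p : SocialChoice.Profile n X => if (F p).pick S = t ∧ t ≠ c.pick S then 1 else 0) ≤
        δ := by
    intro S t
    by_cases h : t ∈ S.1 ∧ t ≠ c.pick S
    · simp only [h.2, ne_eq, not_false_eq_true, and_true]
      refine (SocialChoice.expect_pick_lt hI hN hA hM hα0 hδ0 hνα hν1 (c.pick_mem S) h.1 ?_ hn0
        (Nat.lt_of_ceil_lt hn)).le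
      rw [hscore, hscore]
      refine (add_le_add_right hαW _).trans ?_
      rw [← add_div]
      exact div_le_div_of_nonneg_right (hWS S t h.1 h.2) hW0.le
    · have : ∀ p : SocialChoice.Profile n X, ¬ ((F p).pick S = t ∧ t ≠ c.pick S) := fun p hp =>
        h ⟨hp.1 ▸ (F p).pick_mem S, hp.2⟩
      simp only [this, if_false]
      rw [SharpThreshold.expect_const hν1]
      exact hδ0.le
  by_contra! hcon
  have hone : 1 ≤ ∑ S : SocialChoice.NonemptySubset X, ∑ t : X, SharpThreshold.expect ν
      (fun p : SocialChoice.Profile n X => if (F p).pick S = t ∧ t ≠ c.pick S then 1 else 0) := by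
    simp only [← map_sum]
    refine (SharpThreshold.expect_const (n := n) hν1 1).symm.le.trans
      (SharpThreshold.expect_mono (fun r => hα0.le.trans (hνα r)) fun p => ?_)
    obtain ⟨S, hS⟩ : ∃ S, (F p).pick S ≠ c.pick S := by
      by_contra! h
      exact hcon p (SocialChoice.ChoiceFunction.ext (funext h))
    simp only [Finset.sum_apply]
    let b : SocialChoice.NonemptySubset X → X → ℝ := fun S t =>
      if (F p).pick S = t ∧ t ≠ c.pick S then 1 else 0
    have hb : ∀ S t, 0 ≤ b S t := fun S t => by
      simp only [b]
      split_ifs <;> norm_num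
    calc (1 : ℝ) = b S ((F p).pick S) := by simp [b, hS]
      _ ≤ ∑ t, b S t := Finset.single_le_sum (fun t _ => hb S t) (Finset.mem_univ _)
      _ ≤ ∑ S, ∑ t, b S t := Finset.single_le_sum (f := fun S => ∑ t, b S t)
          (fun S _ => Finset.sum_nonneg fun t _ => hb S t) (Finset.mem_univ S)
  have hle := Finset.sum_le_sum fun S (_ : S ∈ Finset.univ) =>
    Finset.sum_le_sum fun t (_ : t ∈ Finset.univ) => hbad S t
  simp only [Finset.sum_const, Finset.card_univ, nsmul_eq_mul, hX] at hle
  have hcard : (Fintype.card (SocialChoice.NonemptySubset X) : ℝ) ≤ 2 ^ m := by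
    have h := SocialChoice.card_nonemptySubset_le (X := X)
    rw [hX] at h
    exact_mod_cast h
  have hlt : (Fintype.card (SocialChoice.NonemptySubset X) : ℝ) * (m * δ) < 1 := by
    calc _ ≤ 2 ^ m * (m * δ) := mul_le_mul_of_nonneg_right hcard (by positivity)
      _ = 2 ^ m * m / (2 ^ m * m + 1) := by rw [hδ]; ring
      _ < 1 := by
        rw [div_lt_one (by positivity)]
        linarith
  linarith
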